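/- Let $V$ be a closed isometric operator in a complex Hilbert space $H$ (defined on a subspace $D(V)\subseteq H$), and let $U\supseteq V$ be a unitary operator in a Hilbert space $\widetilde H\supseteq H$, with orthogonal spectral measure $E(\delta)$, $\delta\in\mathfrak B(\mathbb T)$, so that $U=\int_{\mathbb T}\zeta\,dE(\zeta)$, where $\mathbb T=\{z\in\mathbb C:|z|=1\}$. Let $P$ be the orthogonal projection of $\widetilde H$ onto $H$, let $$\mathbf F(\delta)=P\,E(\delta)|_H,\qquad \delta\in\mathfrak B(\mathbb T),$$ be the spectral measure of $V$ corresponding to $U$, and let $$\mathbf R_z(V)=P\,(I_{\widetilde H}-zU)^{-1}|_H,\qquad z\in\mathbb D\cup\mathbb D_e,$$ be the corresponding generalized resolvent, where $\mathbb D=\{|z|<1\}$ and $\mathbb D_e=\{|z|>1\}$. Then for every nonempty open arc $\Delta=\{e^{it}:a<t<b\}$ of $\mathbb T$ (where $a<b\le a+2\pi$) the following two conditions are equivalent: (i) $\mathbf F(\Delta)=0$; (ii) $\mathbf R_z(V)$ has an analytic continuation, as a function with values in the bounded operators on $H$ with the operator norm, to the set $\mathbb D\cup\mathbb D_e\cup\overline\Delta$,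 where $\overline\Delta=\{z\in\mathbb C:\overline z\in\Delta\}$. -/

import Mathlib

noncomputable section

open MeasureTheory

/-- The unit circle `𝕋 = {z ∈ ℂ : |z| = 1}` as a topological and (Borel) measurable space. -/
abbrev UnitCircle : Type := Metric.sphere (0 : ℂ) 1

/-- A (nonempty) open arc `{e^{it} : a < t < b}` of the unit circle, `a < b ≤ a + 2π`. -/
def IsOpenArc (Δ : Set UnitCircle) : Prop :=
  ∃ a b : ℝ, a < b ∧ b ≤ a + 2 * Real.pi ∧
    Δ = {ζ : UnitCircle | ∃ t ∈ Set.Ioo a b, (ζ : ℂ) = Complex.exp (t * Complex.I)}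

/-- The conjugate set `{z ∈ ℂ : conj z ∈ Δ}` of a subset `Δ` of the unit circle. -/
def conjArc (Δ : Set UnitCircle) : Set ℂ :=
  {z : ℂ | ∃ ζ ∈ Δ, (starRingEnd ℂ) z = (ζ : ℂ)}

/-- The set `{|z| ≠ 1}`, i.e. the union of the open unit disc and of the exterior `{|z| > 1}`
of the closed unit disc. -/
def offCircle : Set ℂ := {z : ℂ | ‖z‖ < 1} ∪ {z : ℂ | 1 < ‖z‖}

/-- The function `R`, considered on `S₀` only, has an analytic continuation to `S`. -/
def HasAnalyticContinuation {A : Type*} [NormedAddCommGroup A] [NormedSpace ℂ A]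
    (R : ℂ → A) (S₀ S : Set ℂ) : Prop :=
  ∃ G : ℂ → A, AnalyticOnNhd ℂ G S ∧ Set.EqOn G R S₀

/-- A closed isometric operator in `H`, defined on a linear subspace `V.domain` of `H`. -/
structure IsClosedIsometric {H : Type*} [NormedAddCommGroup H] [InnerProductSpace ℂ H]
    (V : H →ₗ.[ℂ] H) : Prop where
  closed : V.IsClosed
  isometric : ∀ x : V.domain, ‖V x‖ = ‖(x : H)‖

/-- A unitary extension `U ⊇ V` in a Hilbert space `K ⊇ H`; the inclusion of `H` in `K` is a linear
isometry `incl`. -/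
structure UnitaryExtension {H : Type*} [NormedAddCommGroup H] [InnerProductSpace ℂ H]
    (V : H →ₗ.[ℂ] H) (K : Type*) [NormedAddCommGroup K] [InnerProductSpace ℂ K]
    [CompleteSpace K] where
  /-- the inclusion `H ⊆ K` -/
  incl : H →ₗᵢ[ℂ] K
  /-- the unitary operator `U` -/
  op : K →L[ℂ] K
  op_unitary : op ∈ unitary (K →L[ℂ] K)
  extends_op : ∀ x : V.domain, op (incl (x : H)) = incl (V x)

/-- An orthogonal spectral measure (projection-valued measure) on the Borel sets of the unit circle:
its values are orthogonal projections in `K`, the value at the whole circle is the identity, and it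
is countably additive in the strong operator topology. Values at non-Borel sets are irrelevant. -/
structure OrthogonalSpectralMeasure (K : Type*) [NormedAddCommGroup K] [InnerProductSpace ℂ K]
    [CompleteSpace K] where
  /-- the operator `E(δ)` -/
  toFun : Set UnitCircle → K →L[ℂ] K
  isStarProjection : ∀ δ : Set UnitCircle, MeasurableSet δ → IsStarProjection (toFun δ)
  univ : toFun Set.univ = 1
  iUnion : ∀ δ : ℕ → Set UnitCircle, (∀ n, MeasurableSet (δ n)) →
    (∀ m n, m ≠ n → Disjoint (δ m) (δ n)) →
    ∀ x : K, HasSum (fun n => toFun (δ n) x) (toFun (⋃ n, δ n) x)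

namespace OrthogonalSpectralMeasure

variable {K : Type*} [NormedAddCommGroup K] [InnerProductSpace ℂ K] [CompleteSpace K]

theorem toFun_empty (E : OrthogonalSpectralMeasure K) (x : K) : E.toFun ∅ x = 0 := by
  have h := E.iUnion (fun _ => ∅) (fun _ => MeasurableSet.empty) (fun _ _ _ => disjoint_bot_left) x
  simpa using (tendsto_nhds_unique h.summable.tendsto_atTop_zero tendsto_const_nhds).symm

theorem re_inner_nonneg (E : OrthogonalSpectralMeasure K) {δ : Set UnitCircle}
    (hδ : MeasurableSet δ) (x : K) : 0 ≤ (inner ℂ x (E.toFun δ x)).re := by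
  have hp := E.isStarProjection δ hδ
  have h1 : E.toFun δ (E.toFun δ x) = E.toFun δ x :=
    congrArg (fun T : K →L[ℂ] K => T x) hp.isIdempotentElem.eq
  have h2 : inner ℂ x (E.toFun δ x) = inner ℂ (E.toFun δ x) (E.toFun δ x) := by
    have h3 := hp.isSelfAdjoint.isSymmetric x (E.toFun δ x)
    simp only [ContinuousLinearMap.coe_coe, h1] at h3
    exact h3.symm
  rw [h2]
  exact inner_self_nonneg (𝕜 := ℂ)

/-- The scalar measure `δ ↦ (E(δ) x, x)` on the unit circle. -/
def scalarMeasure (E : OrthogonalSpectralMeasure K) (x : K) : Measure UnitCircle :=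
  Measure.ofMeasurable (fun δ _ => ENNReal.ofReal (inner ℂ x (E.toFun δ x)).re)
    (by simp [E.toFun_empty])
    (by
      intro f hf hd
      have h := E.iUnion f hf (fun m n hmn => hd hmn) x
      have h' : HasSum (fun n => (inner ℂ x (E.toFun (f n) x)).re)
          (inner ℂ x (E.toFun (⋃ n, f n) x)).re :=
        (h.mapL (innerSL ℂ x)).mapL Complex.reCLM
      rw [← h'.tsum_eq]
      exact ENNReal.ofReal_tsum_of_nonneg (fun n => E.re_inner_nonneg (hf n) x) h'.summable)

theorem scalarMeasure_apply (E : OrthogonalSpectralMeasure K) (x : K) {δ : Set UnitCircle}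
    (hδ : MeasurableSet δ) :
    E.scalarMeasure x δ = ENNReal.ofReal (inner ℂ x (E.toFun δ x)).re :=
  Measure.ofMeasurable_apply δ hδ

/-- `E` is the orthogonal spectral measure of the operator `U`: `U = ∫ ζ dE(ζ)` in the weak sense,
`(U x, x) = ∫ ζ d(E(ζ) x, x)` for all `x` (the inner product of Mathlib is linear in its second
argument; by polarization the same identity holds for the sesquilinear forms). -/
def IsSpectralMeasureOf (E : OrthogonalSpectralMeasure K) (U : K →L[ℂ] K) : Prop :=
  ∀ x : K, inner ℂ x (U x) = ∫ ζ : UnitCircle, (ζ : ℂ) ∂(E.scalarMeasure x)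

end OrthogonalSpectralMeasure

namespace UnitaryExtension

variable {H : Type*} [NormedAddCommGroup H] [InnerProductSpace ℂ H] [CompleteSpace H]
  {V : H →ₗ.[ℂ] H}
  {K : Type*} [NormedAddCommGroup K] [InnerProductSpace ℂ K] [CompleteSpace K]

/-- The compression `P T|_H` to `H` of an operator `T` in `K ⊇ H`, where `P` is the orthogonal
projection of `K` onto `H` (as a map to `H`, it is the adjoint of the inclusion). -/
def compression (W : UnitaryExtension V K) (T : K →L[ℂ] K) : H →L[ℂ] H :=
  (ContinuousLinearMap.adjoint W.incl.toContinuousLinearMap) ∘L T ∘L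
    W.incl.toContinuousLinearMap

/-- The generalized resolvent `R_z = P (1 - z U)⁻¹|_H` of `V` corresponding to the extension `U`.
It is meaningful for `|z| ≠ 1`, where `1 - z U` is invertible. -/
def generalizedResolvent (W : UnitaryExtension V K) (z : ℂ) : H →L[ℂ] H :=
  W.compression (Ring.inverse (1 - z • W.op))

/-- The spectral measure `F(δ) = P E(δ)|_H` of `V` corresponding to the extension `U`, where `E` is
the orthogonal spectral measure of `U`. -/
def spectralMeasure (W : UnitaryExtension V K) (E : OrthogonalSpectralMeasure K)
    (δ : Set UnitCircle) : H →L[ℂ] H :=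
  W.compression (E.toFun δ)

end UnitaryExtension

end

noncomputable section

open MeasureTheory Filter Topology

/-! ### Spectral calculus from the weak first-moment identity -/

namespace OrthogonalSpectralMeasure

variable {K : Type*} [NormedAddCommGroup K] [InnerProductSpace ℂ K] [CompleteSpace K]
  (E : OrthogonalSpectralMeasure K)

/-! Since (F(Δ)x, x) = ‖E(Δ)x‖², vanishing of F(Δ) means that H lies in the range of Q = E(Δᶜ),
which reduces U. On H the resolvent is then that of UQ, and 1 - zUQ stays invertible for z in the
conjugate arc: it is the identity on ker Q, and on ran Q it is bounded below by the distance from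
conj z to Δᶜ (`mul_norm_le`, `isUnit_one_sub_smul_mul_of_le`).

Conversely, for y = (1 - zU)⁻¹x the energy identity 2 Re(x, R_z x) - ‖x‖² = (1 - |z|²)‖y‖² changes
sign across the circle, so continuity of an extension at a point of the conjugate arc forces the
radial limit 0 (`tendsto_radial`). At z = (1 - ε) conj ζ the factor 1 - zξ is O(ε) for ξ within ε of
ζ, so the (E(·)x, x)-mass of that ball is at most 4ε times the energy, hence o(ε)
(`scalarMeasure_closedBall_le`). A finite measure with zero density at every point of an arc gives
the arc mass zero (`measure_arc_eq_zero`). Only continuity of the extension on the arc is needed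
here. -/

theorem toFun_union {A B : Set UnitCircle} (hA : MeasurableSet A) (hB : MeasurableSet B)
    (hAB : Disjoint A B) : E.toFun (A ∪ B) = E.toFun A + E.toFun B := by
  ext x
  let f : ℕ → Set UnitCircle := fun n => if n = 0 then A else if n = 1 then B else ∅
  have hf : ∀ n, MeasurableSet (f n) := by
    intro n; simp only [f]; split_ifs <;> simp [hA, hB]
  have hd : ∀ m n, m ≠ n → Disjoint (f m) (f n) := by
    intro m n hmn
    simp only [f]
    split_ifs <;> first | omega | simp [hAB.symm]
  have hU : (⋃ n, f n) = A ∪ B := by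
    ext y
    simp only [Set.mem_iUnion, Set.mem_union, f]
    constructor
    · rintro ⟨n, hn⟩
      split_ifs at hn <;> simp_all
    · rintro (h | h)
      · exact ⟨0, by simpa using h⟩
      · exact ⟨1, by simpa using h⟩
  have h := E.iUnion f hf hd x
  rw [hU] at h
  have h2 := hasSum_sum_of_ne_finset_zero (L := .unconditional ℕ) (f := fun n => E.toFun (f n) x) (s := Finset.range 2)
    (by
      intro n hn
      have : ¬ n < 2 := by simpa using hn
      simp only [f, if_neg (show n ≠ 0 by omega), if_neg (show n ≠ 1 by omega), E.toFun_empty])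
  have h3 := h.unique h2
  simpa [Finset.sum_range_succ, f] using h3

/-- Idempotence of p + q gives pq + qp = 0; multiplying by p on either side shows that p and q
commute, so 2pq = 0. -/
theorem toFun_mul_of_disjoint {A B : Set UnitCircle} (hA : MeasurableSet A) (hB : MeasurableSet B)
    (hAB : Disjoint A B) : E.toFun A * E.toFun B = 0 := by
  have h := (E.isStarProjection _ (hA.union hB)).isIdempotentElem.eq
  rw [E.toFun_union hA hB hAB] at h
  have hp := (E.isStarProjection _ hA).isIdempotentElem.eq
  have hq := (E.isStarProjection _ hB).isIdempotentElem.eq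
  set p := E.toFun A
  set q := E.toFun B
  have h1 : p * q + q * p = 0 := by
    have : (p + q) * (p + q) = p * p + q * q + (p * q + q * p) := by noncomm_ring
    rw [this, hp, hq] at h
    simpa using h
  have h2 : p * q + p * q * p = 0 := by
    calc p * q + p * q * p = p * p * q + p * q * p := by rw [hp]
      _ = p * (p * q + q * p) := by noncomm_ring
      _ = 0 := by rw [h1, mul_zero]
  have h3 : p * q * p + q * p = 0 := by
    calc p * q * p + q * p = p * q * p + q * (p * p) := by rw [hp]
      _ = (p * q + q * p) * p := by noncomm_ring
      _ = 0 := by rw [h1, zero_mul]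
  have h4 : p * q = q * p := by
    rw [eq_neg_of_add_eq_zero_left h2, eq_neg_of_add_eq_zero_right h3]
  rw [← h4, ← two_smul ℂ] at h1
  simpa using h1

theorem toFun_mul {A B : Set UnitCircle} (hA : MeasurableSet A) (hB : MeasurableSet B) :
    E.toFun A * E.toFun B = E.toFun (A ∩ B) := by
  have hAB := hA.inter hB
  have h1 : E.toFun A = E.toFun (A ∩ B) + E.toFun (A \ B) := by
    rw [← E.toFun_union hAB (hA.diff hB) (Set.disjoint_sdiff_inter.symm), Set.inter_union_sdiff]
  have h2 : E.toFun B = E.toFun (A ∩ B) + E.toFun (B \ A) := by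
    rw [← E.toFun_union hAB (hB.diff hA)
      (Set.inter_comm A B ▸ Set.disjoint_sdiff_inter.symm), Set.inter_comm, Set.inter_union_sdiff]
  rw [h1, add_mul, E.toFun_mul_of_disjoint (hA.diff hB) hB Set.disjoint_sdiff_left, add_zero, h2,
    mul_add, E.toFun_mul_of_disjoint hAB (hB.diff hA)
      (Set.disjoint_sdiff_right.mono_left Set.inter_subset_left), add_zero,
    (E.isStarProjection _ hAB).isIdempotentElem.eq]

theorem toFun_apply_apply {A B : Set UnitCircle} (hA : MeasurableSet A) (hB : MeasurableSet B)
    (x : K) : E.toFun A (E.toFun B x) = E.toFun (A ∩ B) x := by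
  rw [← E.toFun_mul hA hB]; rfl

theorem inner_toFun_left {A : Set UnitCircle} (hA : MeasurableSet A) (x y : K) :
    inner ℂ (E.toFun A x) y = inner ℂ x (E.toFun A y) :=
  (E.isStarProjection A hA).isSelfAdjoint.isSymmetric x y

theorem inner_toFun_self {A : Set UnitCircle} (hA : MeasurableSet A) (x : K) :
    inner ℂ x (E.toFun A x) = ((‖E.toFun A x‖ ^ 2 : ℝ) : ℂ) := by
  have h := E.toFun_apply_apply hA hA x
  rw [Set.inter_self] at h
  conv_lhs => rw [← h, ← E.inner_toFun_left hA]
  rw [inner_self_eq_norm_sq_to_K]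
  simp

theorem scalarMeasure_apply_eq_norm_sq {A : Set UnitCircle} (hA : MeasurableSet A) (x : K) :
    E.scalarMeasure x A = ENNReal.ofReal (‖E.toFun A x‖ ^ 2) := by
  rw [E.scalarMeasure_apply x hA, E.inner_toFun_self hA, Complex.ofReal_re]

instance (x : K) : IsFiniteMeasure (E.scalarMeasure x) :=
  ⟨by rw [E.scalarMeasure_apply x MeasurableSet.univ]; exact ENNReal.ofReal_lt_top⟩

theorem scalarMeasure_real_univ (x : K) : (E.scalarMeasure x).real Set.univ = ‖x‖ ^ 2 := by
  rw [measureReal_def, E.scalarMeasure_apply_eq_norm_sq MeasurableSet.univ, E.univ,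
    ENNReal.toReal_ofReal (by positivity)]
  simp

/-- The scalar measure of a vector of the range of `E A` is concentrated on `A`. -/
theorem ae_mem_of_toFun_eq {A : Set UnitCircle} (hA : MeasurableSet A) {x : K}
    (hx : E.toFun A x = x) : ∀ᵐ ζ ∂(E.scalarMeasure x), ζ ∈ A := by
  rw [ae_iff]
  change E.scalarMeasure x Aᶜ = 0
  rw [E.scalarMeasure_apply_eq_norm_sq hA.compl, ← hx, E.toFun_apply_apply hA.compl hA,
    Set.compl_inter_self, E.toFun_empty]
  simp

theorem scalarMeasure_add {A : Set UnitCircle} (hA : MeasurableSet A) {x y : K}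
    (hx : E.toFun A x = x) (hy : E.toFun A y = 0) :
    E.scalarMeasure (x + y) = E.scalarMeasure x + E.scalarMeasure y := by
  ext B hB
  have hxy : inner ℂ x (E.toFun B y) = 0 := by
    rw [← hx, E.inner_toFun_left hA, E.toFun_apply_apply hA hB, Set.inter_comm,
      ← E.toFun_apply_apply hB hA, hy, map_zero, inner_zero_right]
  have hyx : inner ℂ y (E.toFun B x) = 0 := by
    rw [← E.inner_toFun_left hB, ← inner_conj_symm, hxy, map_zero]
  rw [Measure.add_apply, E.scalarMeasure_apply _ hB, E.scalarMeasure_apply _ hB,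
    E.scalarMeasure_apply _ hB,
    ← ENNReal.ofReal_add (E.re_inner_nonneg hB x) (E.re_inner_nonneg hB y)]
  simp [hxy, hyx]

theorem integrable_of_continuous (x : K) {F : Type*} [NormedAddCommGroup F]
    {f : UnitCircle → F} (hf : Continuous f) : Integrable f (E.scalarMeasure x) :=
  hf.integrable_of_hasCompactSupport (HasCompactSupport.of_compactSpace f)

variable {E} {U : K →L[ℂ] K}

theorem IsSpectralMeasureOf.inner_add_inner_eq_zero (hE : E.IsSpectralMeasureOf U)
    {A : Set UnitCircle} (hA : MeasurableSet A) {x y : K} (hx : E.toFun A x = x)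
    (hy : E.toFun A y = 0) : inner ℂ x (U y) + inner ℂ y (U x) = 0 := by
  have h := hE (x + y)
  rw [E.scalarMeasure_add hA hx hy, integral_add_measure
    (E.integrable_of_continuous x continuous_subtype_val)
    (E.integrable_of_continuous y continuous_subtype_val), ← hE x, ← hE y] at h
  simp only [map_add, inner_add_left, inner_add_right] at h
  linear_combination h

/-- The spectral identity is given only on the diagonal. Applied to x + y it kills the sum of the
cross terms; replacing y by iy separates them. -/
theorem IsSpectralMeasureOf.inner_eq_zero (hE : E.IsSpectralMeasureOf U)
    {A : Set UnitCircle} (hA : MeasurableSet A) {x y : K} (hx : E.toFun A x = x)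
    (hy : E.toFun A y = 0) : inner ℂ x (U y) = 0 ∧ inner ℂ y (U x) = 0 := by
  have h1 := hE.inner_add_inner_eq_zero hA hx hy
  have h2 := hE.inner_add_inner_eq_zero hA hx (y := Complex.I • y) (by rw [map_smul, hy, smul_zero])
  rw [map_smul, inner_smul_left, inner_smul_right, Complex.conj_I] at h2
  have h3 : inner ℂ x (U y) = 0 := by
    linear_combination (1 / 2 : ℂ) * h1 - (Complex.I / 2) * h2
      + ((inner ℂ x (U y) - inner ℂ y (U x)) / 2) * Complex.I_sq
  rw [h3, zero_add] at h1
  exact ⟨h3, h1⟩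

theorem IsSpectralMeasureOf.commute (hE : E.IsSpectralMeasureOf U)
    {A : Set UnitCircle} (hA : MeasurableSet A) : Commute U (E.toFun A) := by
  have hi : ∀ z, E.toFun A (E.toFun A z) = E.toFun A z := fun z => by
    rw [E.toFun_apply_apply hA hA, Set.inter_self]
  have h0 : ∀ z, E.toFun A (z - E.toFun A z) = 0 := fun z => by rw [map_sub, hi, sub_self]
  refine ContinuousLinearMap.ext fun z => ext_inner_left ℂ fun w => ?_
  change inner ℂ w (U (E.toFun A z)) = inner ℂ w (E.toFun A (U z))
  rw [← E.inner_toFun_left hA]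
  have h1 := (hE.inner_eq_zero hA (hi z) (h0 w)).2
  have h2 := (hE.inner_eq_zero hA (hi w) (h0 z)).1
  rw [inner_sub_left, sub_eq_zero] at h1
  rw [map_sub, inner_sub_right, sub_eq_zero] at h2
  rw [h1, h2]

theorem norm_apply_of_unitary (hU : U ∈ unitary (K →L[ℂ] K)) (x : K) : ‖U x‖ = ‖x‖ :=
  (⟨U, hU⟩ : unitary (K →L[ℂ] K)) |> fun u => Unitary.norm_map u x

/-- As U is isometric and |ζ| = 1, expanding both squares leaves only first moments, so no
functional calculus beyond the defining identity is required. -/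
theorem IsSpectralMeasureOf.norm_sq_sub_smul (hE : E.IsSpectralMeasureOf U)
    (hU : U ∈ unitary (K →L[ℂ] K)) (z : ℂ) (x : K) :
    ‖x - z • U x‖ ^ 2 = ∫ ζ : UnitCircle, ‖1 - z * (ζ : ℂ)‖ ^ 2 ∂(E.scalarMeasure x) := by
  have h1 : ∀ ζ : UnitCircle, ‖1 - z * (ζ : ℂ)‖ ^ 2
      = 1 + ‖z‖ ^ 2 - 2 * (z * (ζ : ℂ)).re := by
    intro ζ
    have hζ : ‖(ζ : ℂ)‖ = 1 := by simp
    have := @norm_sub_sq_real ℂ _ _ 1 (z * (ζ : ℂ))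
    rw [this, Complex.inner, norm_mul, hζ]
    simp
    ring
  have hint : Integrable (fun ζ : UnitCircle => z * (ζ : ℂ)) (E.scalarMeasure x) :=
    E.integrable_of_continuous x (by fun_prop)
  have hre : Integrable (fun ζ : UnitCircle => 2 * (z * (ζ : ℂ)).re) (E.scalarMeasure x) :=
    E.integrable_of_continuous x (by fun_prop)
  have h2 : ∫ ζ : UnitCircle, (z * (ζ : ℂ)).re ∂(E.scalarMeasure x) = (z * inner ℂ x (U x)).re := by
    rw [hE x, ← integral_const_mul]
    exact integral_re hint
  simp only [h1]
  rw [integral_sub (integrable_const _) hre, integral_const_mul, h2, integral_const, E.scalarMeasure_real_univ, @norm_sub_sq ℂ, norm_smul,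
    norm_apply_of_unitary hU, inner_smul_right]
  simp
  ring

/-- Lower bound for `1 - z U` on the range of `E A`. -/
theorem IsSpectralMeasureOf.mul_norm_le (hE : E.IsSpectralMeasureOf U)
    (hU : U ∈ unitary (K →L[ℂ] K)) {A : Set UnitCircle} (hA : MeasurableSet A) {z : ℂ} {c : ℝ}
    (hc0 : 0 ≤ c) (hc : ∀ ζ ∈ A, c ≤ ‖1 - z * (ζ : ℂ)‖) {x : K} (hx : E.toFun A x = x) :
    c * ‖x‖ ≤ ‖x - z • U x‖ := by
  refine le_of_sq_le_sq ?_ (norm_nonneg _)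
  rw [hE.norm_sq_sub_smul hU, mul_pow, ← E.scalarMeasure_real_univ, mul_comm, ← smul_eq_mul,
    ← integral_const]
  refine integral_mono_ae (integrable_const _) (E.integrable_of_continuous x (by fun_prop)) ?_
  filter_upwards [E.ae_mem_of_toFun_eq hA hx] with ζ hζ
  have := hc ζ hζ
  gcongr

/-- Upper bound for `1 - z U` on the range of `E A`. -/
theorem IsSpectralMeasureOf.norm_le_mul (hE : E.IsSpectralMeasureOf U)
    (hU : U ∈ unitary (K →L[ℂ] K)) {A : Set UnitCircle} (hA : MeasurableSet A) {z : ℂ} {c : ℝ}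
    (hc0 : 0 ≤ c) (hc : ∀ ζ ∈ A, ‖1 - z * (ζ : ℂ)‖ ≤ c) {x : K} (hx : E.toFun A x = x) :
    ‖x - z • U x‖ ≤ c * ‖x‖ := by
  refine le_of_sq_le_sq ?_ (by positivity)
  rw [hE.norm_sq_sub_smul hU, mul_pow, ← E.scalarMeasure_real_univ, mul_comm (c ^ 2),
    ← smul_eq_mul, ← integral_const]
  refine integral_mono_ae (E.integrable_of_continuous x (by fun_prop)) (integrable_const _) ?_
  filter_upwards [E.ae_mem_of_toFun_eq hA hx] with ζ hζ
  have := hc ζ hζ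
  gcongr

end OrthogonalSpectralMeasure

/-! ### Invertibility of 1 - zU and 1 - zUQ, and the energy identity -/

theorem isUnit_one_sub_smul_of_unitary {A : Type*} [CStarAlgebra A] {u : A}
    (hu : u ∈ unitary A) {z : ℂ} (hz : z ∈ offCircle) : IsUnit (1 - z • u) := by
  have hz1 : ‖z‖ ≠ 1 := by
    rcases hz with h | h
    · exact ne_of_lt h
    · exact ne_of_gt h
  rcases eq_or_ne z 0 with rfl | hz0
  · simp
  have h : z⁻¹ ∉ spectrum ℂ u := fun h => by
    have := spectrum.subset_circle_of_unitary hu h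
    rw [mem_sphere_zero_iff_norm, norm_inv, inv_eq_one] at this
    exact hz1 this
  rw [spectrum.notMem_iff, Algebra.algebraMap_eq_smul_one] at h
  have h2 := h.smul (Units.mk0 z hz0)
  rwa [Units.smul_mk0, smul_sub, smul_smul, mul_inv_cancel₀ hz0, one_smul] at h2

section Operators

variable {K : Type*} [NormedAddCommGroup K] [InnerProductSpace ℂ K] [CompleteSpace K]
  {U Q : K →L[ℂ] K}

/-- A normal operator which is bounded below is invertible. -/
theorem ContinuousLinearMap.isUnit_of_isStarNormal_of_le_norm {T : K →L[ℂ] K} (hT : IsStarNormal T)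
    {c : ℝ} (hc : 0 < c) (h : ∀ x, c * ‖x‖ ^ 2 ≤ ‖T x‖ ^ 2) : IsUnit T := by
  -- T*T is coercive, hence invertible; normality passes this to the factor T.
  have h1 : IsUnit (star T * T) := by
    refine ContinuousLinearMap.isUnit_of_forall_le_norm_inner_map _ (c := NNReal.mk c hc.le) hc fun x => ?_
    rw [mul_apply_eq_comp, ContinuousLinearMap.star_eq_adjoint,
      ContinuousLinearMap.adjoint_inner_left, inner_self_eq_norm_sq_to_K]
    rw [NNReal.coe_mk, mul_comm]
    simpa using h x
  exact (hT.star_comm_self.isUnit_mul_iff.mp h1).2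

theorem isUnit_one_sub_smul_mul_of_le (hU : U ∈ unitary (K →L[ℂ] K)) (hQ : IsStarProjection Q)
    (hUQ : Commute U Q) {z : ℂ} {c : ℝ} (hc : 0 < c)
    (h : ∀ x, Q x = x → c * ‖x‖ ≤ ‖x - z • U x‖) : IsUnit (1 - z • (U * Q)) := by
  have hQQ : Q * Q = Q := hQ.isIdempotentElem.eq
  have hQs : star Q = Q := hQ.isSelfAdjoint.star_eq
  have hN : Commute (star (U * Q)) (U * Q) := by
    have h1 : star (U * Q) * (U * Q) = Q := by
      rw [star_mul, hQs, mul_assoc, ← mul_assoc (star U), Unitary.star_mul_self_of_mem hU, one_mul,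
        hQQ]
    have h2 : (U * Q) * star (U * Q) = Q := by
      rw [star_mul, hQs, mul_assoc, ← mul_assoc Q, hQQ, ← mul_assoc, hUQ.eq, mul_assoc,
        Unitary.mul_star_self_of_mem hU, mul_one]
    rw [Commute, SemiconjBy, h1, h2]
  have hT : IsStarNormal (1 - z • (U * Q)) := by
    refine ⟨?_⟩
    rw [star_sub, star_one, star_smul]
    refine Commute.sub_left (Commute.one_left _) (Commute.sub_right (Commute.one_right _) ?_)
    exact (hN.smul_left _).smul_right _
  -- The bound is 1 on ker Q, where the operator is the identity, and c² on ran Q; the two parts are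
  -- orthogonal.
  refine ContinuousLinearMap.isUnit_of_isStarNormal_of_le_norm hT
    (c := min 1 (c ^ 2)) (by positivity) fun x => ?_
  have hQx : Q (Q x) = Q x := congrArg (fun T : K →L[ℂ] K => T x) hQQ
  have hUx : ∀ y, U (Q y) = Q (U y) := fun y => congrArg (fun T : K →L[ℂ] K => T y) hUQ.eq
  have hsymm : ∀ v w, inner ℂ (Q v) w = inner ℂ v (Q w) := hQ.isSelfAdjoint.isSymmetric
  have orth : ∀ v, Q v = v → ‖(x - Q x) + v‖ ^ 2 = ‖x - Q x‖ ^ 2 + ‖v‖ ^ 2 := by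
    intro v hv
    rw [@norm_add_sq ℂ, ← hv, ← hsymm, map_sub, hQx, sub_self, inner_zero_left]
    simp
  have e1 : (1 - z • (U * Q)) x = (x - Q x) + (Q x - z • U (Q x)) := by simp
  have e2 := orth (Q x) hQx
  rw [sub_add_cancel] at e2
  rw [e1, orth _ (by rw [map_sub, map_smul, ← hUx, hQx]), e2, mul_add]
  have h2 : (c * ‖Q x‖) ^ 2 ≤ ‖Q x - z • U (Q x)‖ ^ 2 := by
    gcongr
    exact h _ hQx
  rw [mul_pow] at h2
  have h3 := mul_le_mul_of_nonneg_right (min_le_left 1 (c ^ 2)) (sq_nonneg ‖x - Q x‖)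
  have h4 := mul_le_mul_of_nonneg_right (min_le_right 1 (c ^ 2)) (sq_nonneg ‖Q x‖)
  linarith

theorem isUnit_one_sub_smul_mul_of_isUnit (hQ : IsStarProjection Q) (hUQ : Commute U Q) {z : ℂ}
    (h : IsUnit (1 - z • U)) : IsUnit (1 - z • (U * Q)) := by
  have hQQ : Q * Q = Q := hQ.isIdempotentElem.eq
  obtain ⟨u, hu⟩ := h
  have hc : Commute (u : K →L[ℂ] K) Q := by
    rw [hu]; exact (Commute.one_left _).sub_left (hUQ.smul_left z)
  have hc' : ((u⁻¹ : (K →L[ℂ] K)ˣ) : K →L[ℂ] K) * Q = Q * (u⁻¹ : (K →L[ℂ] K)ˣ) :=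
    hc.units_inv_left.eq
  have e : 1 - z • (U * Q) = u * Q + (1 - Q) := by rw [hu]; simp [sub_mul]
  have z1 : Q * (1 - Q) = 0 := by rw [mul_sub, mul_one, hQQ, sub_self]
  have z2 : (1 - Q) * Q = 0 := by rw [sub_mul, one_mul, hQQ, sub_self]
  have z3 : (1 - Q) * (1 - Q) = 1 - Q := by rw [mul_sub, z2, sub_zero, mul_one]
  -- The inverse is assembled blockwise: u⁻¹ on ran Q, the identity on ker Q.
  refine ⟨⟨u * Q + (1 - Q), Q * (u⁻¹ : (K →L[ℂ] K)ˣ) + (1 - Q), ?_, ?_⟩, e.symm⟩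
  · have : ((u : K →L[ℂ] K) * Q + (1 - Q)) * (Q * (u⁻¹ : (K →L[ℂ] K)ˣ) + (1 - Q))
        = u * (Q * Q) * (u⁻¹ : (K →L[ℂ] K)ˣ) + u * (Q * (1 - Q))
          + ((1 - Q) * Q) * (u⁻¹ : (K →L[ℂ] K)ˣ) + (1 - Q) * (1 - Q) := by noncomm_ring
    rw [this, hQQ, z1, z2, z3, hc.eq, mul_assoc, Units.mul_inv]
    simp
  · have : (Q * (u⁻¹ : (K →L[ℂ] K)ˣ) + (1 - Q)) * ((u : K →L[ℂ] K) * Q + (1 - Q))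
        = Q * ((u⁻¹ : (K →L[ℂ] K)ˣ) * (u : K →L[ℂ] K)) * Q
          + Q * (u⁻¹ : (K →L[ℂ] K)ˣ) * (1 - Q)
          + (1 - Q) * ((u : K →L[ℂ] K) * Q) + (1 - Q) * (1 - Q) := by noncomm_ring
    rw [this, Units.inv_mul, ← hc', mul_assoc _ Q (1 - Q), z1, hc.eq, ← mul_assoc (1 - Q), z2, z3,
      mul_one, hQQ]
    simp

/-- The energy identity for a solution `y` of `y - z U y = h` with `U` isometric. -/
theorem two_mul_re_inner_sub_norm_sq (hU : U ∈ unitary (K →L[ℂ] K)) {z : ℂ} {h y : K}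
    (hy : y - z • U y = h) :
    2 * (inner ℂ h y).re - ‖h‖ ^ 2 = (1 - ‖z‖ ^ 2) * ‖y‖ ^ 2 := by
  have h1 : z • U y = y - h := by rw [← hy, sub_sub_cancel]
  have h2 : ‖z‖ * ‖y‖ = ‖y - h‖ := by
    rw [← h1, norm_smul, OrthogonalSpectralMeasure.norm_apply_of_unitary hU]
  have h3 := @norm_sub_sq ℂ _ _ _ _ y h
  rw [← h2, inner_re_symm] at h3
  simp only [RCLike.re_eq_complex_re] at h3
  linear_combination h3

end Operators

/-! ### Arcs and measures of zero density -/

theorem IsOpenArc.isOpen {Δ : Set UnitCircle} (hΔ : IsOpenArc Δ) : IsOpen Δ := by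
  obtain ⟨a, b, -, -, rfl⟩ := hΔ
  have h1 : IsOpen (Complex.exp '' {w : ℂ | w.im ∈ Set.Ioo a b}) :=
    Complex.isOpenMap_exp _ (isOpen_Ioo.preimage Complex.continuous_im)
  convert h1.preimage (continuous_subtype_val (p := (· ∈ Metric.sphere (0 : ℂ) 1))) using 1
  ext ζ
  simp only [Set.mem_ofPred_eq, Set.mem_preimage, Set.mem_image]
  constructor
  · rintro ⟨t, ht, h⟩
    exact ⟨t * Complex.I, by simpa using ht, h.symm⟩
  · rintro ⟨w, hw, h⟩
    refine ⟨w.im, hw, ?_⟩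
    have hζ : ‖(ζ : ℂ)‖ = 1 := by simp
    have hre : w.re = 0 := by rwa [← h, Complex.norm_exp, Real.exp_eq_one_iff] at hζ
    rw [← h]
    congr 1
    apply Complex.ext <;> simp [hre]

/-- A finite measure on the circle whose density vanishes at every point of an arc vanishes on
that arc. -/
theorem measure_arc_eq_zero (μ : Measure UnitCircle) [IsFiniteMeasure μ] {a b : ℝ}
    (h : ∀ ζ : UnitCircle, (∃ t ∈ Set.Ioo a b, (ζ : ℂ) = Complex.exp (t * Complex.I)) →
      ∀ η > 0, ∀ᶠ ε in 𝓝[>] (0 : ℝ), μ.real (Metric.closedBall ζ ε) ≤ η * ε) :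
    μ {ζ : UnitCircle | ∃ t ∈ Set.Ioo a b, (ζ : ℂ) = Complex.exp (t * Complex.I)} = 0 := by
  -- Half-open arcs play the role of a distribution function. The comparisons below need only that t
  -- ↦ e^{it} is 1-Lipschitz, not that it is injective.
  let arc : ℝ → ℝ → Set UnitCircle := fun c d =>
    {ζ : UnitCircle | ∃ s ∈ Set.Ioc c d, (ζ : ℂ) = Complex.exp (s * Complex.I)}
  let pt : ℝ → UnitCircle := fun t => ⟨Complex.exp (t * Complex.I), by simp⟩
  have hdist : ∀ s t : ℝ, ‖Complex.exp (s * Complex.I) - Complex.exp (t * Complex.I)‖ ≤ |s - t| := by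
    intro s t
    have : Complex.exp (s * Complex.I) - Complex.exp (t * Complex.I)
        = Complex.exp (t * Complex.I) * (Complex.exp (Complex.I * ((s - t : ℝ) : ℂ)) - 1) := by
      rw [mul_sub, ← Complex.exp_add, mul_one]
      push_cast
      ring_nf
    rw [this, norm_mul, Complex.norm_exp_ofReal_mul_I, one_mul]
    exact Real.norm_exp_I_mul_ofReal_sub_one_le
  have hsub : ∀ c s t : ℝ, arc c s ⊆ arc c t ∪ Metric.closedBall (pt t) |s - t| := by
    rintro c s t ζ ⟨r, hr, hζ⟩
    by_cases hrt : r ≤ t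
    · exact Or.inl ⟨r, ⟨hr.1, hrt⟩, hζ⟩
    · right
      rw [Metric.mem_closedBall, Subtype.dist_eq, hζ, dist_eq_norm]
      refine (hdist r t).trans ?_
      rw [abs_of_pos (by linarith), abs_of_pos (by linarith [hr.2])]
      linarith [hr.2]
  have hsub' : ∀ c s t : ℝ, arc c t ⊆ arc c s ∪ Metric.closedBall (pt t) |s - t| := by
    rintro c s t ζ ⟨r, hr, hζ⟩
    by_cases hrt : r ≤ s
    · exact Or.inl ⟨r, ⟨hr.1, hrt⟩, hζ⟩
    · right
      rw [Metric.mem_closedBall, Subtype.dist_eq, hζ, dist_eq_norm]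
      refine (hdist r t).trans ?_
      rw [abs_sub_comm, abs_of_nonneg (by linarith [hr.2]), abs_sub_comm,
        abs_of_pos (by linarith [hr.2])]
      linarith [hr.2]
  have hF : ∀ c s t : ℝ, |μ.real (arc c s) - μ.real (arc c t)|
      ≤ μ.real (Metric.closedBall (pt t) |s - t|) := by
    intro c s t
    have h1 := (measureReal_mono (μ := μ) (hsub c s t)).trans (measureReal_union_le _ _)
    have h2 := (measureReal_mono (μ := μ) (hsub' c s t)).trans (measureReal_union_le _ _)
    rw [abs_le]
    constructor <;> linarith
  -- The increment between s and t is at most the mass of a ball of radius |s - t|, which is o(|s -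
  -- t|) by the density hypothesis.
  have hderiv : ∀ c, ∀ t ∈ Set.Ioo a b, HasDerivAt (fun s => μ.real (arc c s)) 0 t := by
    intro c t ht
    rw [hasDerivAt_iff_isLittleO, Asymptotics.isLittleO_iff]
    intro η hη
    have h1 := h (pt t) ⟨t, ht, rfl⟩ η hη
    rw [eventually_nhdsWithin_iff] at h1
    have h2 : Tendsto (fun s : ℝ => |s - t|) (𝓝 t) (𝓝 0) := by
      have : Continuous fun s : ℝ => |s - t| := by fun_prop
      simpa using this.tendsto t
    filter_upwards [h2.eventually h1] with s hs
    rcases eq_or_ne s t with rfl | hst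
    · simp
    · have h3 := hs (abs_pos.mpr (sub_ne_zero.mpr hst))
      simpa using (hF c s t).trans h3
  have hconst : ∀ c ∈ Set.Ioo a b, ∀ d ∈ Set.Ioo a b, μ (arc c d) = 0 := by
    intro c hc d hd
    have h1 := isOpen_Ioo.is_const_of_deriv_eq_zero isPreconnected_Ioo
      (fun t ht => (hderiv c t ht).differentiableAt.differentiableWithinAt)
      (fun t ht => (hderiv c t ht).deriv) hd hc
    have h2 : arc c c = ∅ := by
      ext ζ; simp [arc]
    simp only [h2, measureReal_empty] at h1
    exact (measureReal_eq_zero_iff).mp h1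
  -- Rational endpoints strictly inside (a, b) make the exhaustion countable and avoid the ends,
  -- where nothing is assumed about the density.
  have hcover : {ζ : UnitCircle | ∃ t ∈ Set.Ioo a b, (ζ : ℂ) = Complex.exp (t * Complex.I)}
      ⊆ ⋃ (p : ℚ) (q : ℚ) (_ : (p : ℝ) ∈ Set.Ioo a b) (_ : (q : ℝ) ∈ Set.Ioo a b),
        arc p q := by
    rintro ζ ⟨t, ht, hζ⟩
    obtain ⟨p, hp1, hp2⟩ := exists_rat_btwn ht.1
    obtain ⟨q, hq1, hq2⟩ := exists_rat_btwn ht.2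
    simp only [Set.mem_iUnion]
    exact ⟨p, q, ⟨hp1, hp2.trans ht.2⟩, ⟨ht.1.trans hq1, hq2⟩, t, ⟨hp2, hq1.le⟩, hζ⟩
  refine measure_mono_null hcover ?_
  simp only [measure_iUnion_null_iff]
  exact fun p q hp hq => hconst p hp q hq

/-! ### Estimates near a point of the circle -/

namespace OrthogonalSpectralMeasure

variable {K : Type*} [NormedAddCommGroup K] [InnerProductSpace ℂ K] [CompleteSpace K]
  {E : OrthogonalSpectralMeasure K} {U : K →L[ℂ] K}

/-- Because E(A) commutes with U, E(A)h = (1 - zU)E(A)y, and the upper bound on ran E(A) applies. -/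
theorem IsSpectralMeasureOf.norm_toFun_le (hE : E.IsSpectralMeasureOf U)
    (hU : U ∈ unitary (K →L[ℂ] K)) {A : Set UnitCircle} (hA : MeasurableSet A) {z : ℂ} {c : ℝ}
    (hc0 : 0 ≤ c) (hc : ∀ ζ ∈ A, ‖1 - z * (ζ : ℂ)‖ ≤ c) {h y : K} (hy : y - z • U y = h) :
    ‖E.toFun A h‖ ≤ c * ‖y‖ := by
  have hcomm : U (E.toFun A y) = E.toFun A (U y) :=
    congrArg (fun T : K →L[ℂ] K => T y) (hE.commute hA).eq
  have hAA : E.toFun A (E.toFun A y) = E.toFun A y := by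
    rw [E.toFun_apply_apply hA hA, Set.inter_self]
  have h1 := hE.norm_le_mul hU hA hc0 hc hAA
  rw [hcomm, ← map_smul, ← map_sub, hy] at h1
  refine h1.trans (mul_le_mul_of_nonneg_left ?_ hc0)
  have h2 : ‖E.toFun A y‖ ^ 2 ≤ ‖y‖ ^ 2 := by
    rw [← E.scalarMeasure_real_univ y]
    have h3 := E.scalarMeasure_apply_eq_norm_sq hA y
    have h4 : (E.scalarMeasure y).real A = ‖E.toFun A y‖ ^ 2 := by
      rw [measureReal_def, h3, ENNReal.toReal_ofReal (by positivity)]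
    rw [← h4]
    exact measureReal_mono (Set.subset_univ A)
  exact le_of_sq_le_sq h2 (norm_nonneg _)

end OrthogonalSpectralMeasure

theorem norm_one_sub_le_of_mem_closedBall {ζ ξ : UnitCircle} {ε : ℝ} (hε0 : 0 ≤ ε) (hε1 : ε ≤ 1)
    (hξ : ξ ∈ Metric.closedBall ζ ε) :
    ‖1 - (((1 - ε : ℝ) : ℂ) * (starRingEnd ℂ) (ζ : ℂ)) * (ξ : ℂ)‖ ≤ 2 * ε := by
  have hζ : ‖(ζ : ℂ)‖ = 1 := by simp
  have hmul : (starRingEnd ℂ) (ζ : ℂ) * ζ = 1 := by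
    rw [mul_comm, Complex.mul_conj, Complex.normSq_eq_norm_sq, hζ]; simp
  have e : 1 - (((1 - ε : ℝ) : ℂ) * (starRingEnd ℂ) (ζ : ℂ)) * (ξ : ℂ)
      = (ε : ℂ) - ((1 - ε : ℝ) : ℂ) * ((starRingEnd ℂ) (ζ : ℂ) * ((ξ : ℂ) - ζ)) := by
    push_cast
    linear_combination (-(1 - (ε : ℂ))) * hmul
  have hd : ‖(ξ : ℂ) - ζ‖ ≤ ε := by
    rwa [Metric.mem_closedBall, Subtype.dist_eq, dist_eq_norm] at hξ
  rw [e]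
  refine (norm_sub_le _ _).trans ?_
  rw [norm_mul, norm_mul, Complex.norm_real, Complex.norm_real, RCLike.norm_conj, hζ,
    Real.norm_of_nonneg hε0, Real.norm_of_nonneg (by linarith)]
  nlinarith [norm_nonneg ((ξ : ℂ) - ζ)]

/-! ### Compressions to H and the two implications -/

namespace UnitaryExtension

variable {H : Type*} [NormedAddCommGroup H] [InnerProductSpace ℂ H] [CompleteSpace H]
  {V : H →ₗ.[ℂ] H}
  {K : Type*} [NormedAddCommGroup K] [InnerProductSpace ℂ K] [CompleteSpace K]
  (W : UnitaryExtension V K)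

theorem inner_compression (T : K →L[ℂ] K) (x y : H) :
    inner ℂ x (W.compression T y) = inner ℂ (W.incl x) (T (W.incl y)) := by
  simp [compression, ContinuousLinearMap.adjoint_inner_right]

theorem compression_eq_zero_iff {E : OrthogonalSpectralMeasure K} {A : Set UnitCircle}
    (hA : MeasurableSet A) :
    W.compression (E.toFun A) = 0 ↔ ∀ x, E.toFun A (W.incl x) = 0 := by
  constructor
  · intro h x
    have h1 := W.inner_compression (E.toFun A) x x
    rw [h, E.inner_toFun_self hA] at h1
    simpa using h1.symm
  · intro h
    ext x
    simp [compression, h x]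

theorem analyticAt_compression {f : ℂ → K →L[ℂ] K} {z : ℂ} (hf : AnalyticAt ℂ f z) :
    AnalyticAt ℂ (fun w => W.compression (f w)) z := by
  let L : (K →L[ℂ] K) →L[ℂ] (H →L[ℂ] H) :=
    (ContinuousLinearMap.compL ℂ H K H (ContinuousLinearMap.adjoint W.incl.toContinuousLinearMap)) ∘L
      ((ContinuousLinearMap.compL ℂ H K K).flip W.incl.toContinuousLinearMap)
  have h : AnalyticAt ℂ (L ∘ f) z := (L.analyticAt (f z)).comp hf
  exact h

theorem hasAnalyticContinuation_of_spectralMeasure_eq_zero {E : OrthogonalSpectralMeasure K}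
    (hE : E.IsSpectralMeasureOf W.op) {Δ : Set UnitCircle} (hΔ : IsOpen Δ)
    (h : W.spectralMeasure E Δ = 0) :
    HasAnalyticContinuation W.generalizedResolvent offCircle (offCircle ∪ conjArc Δ) := by
  have hm := hΔ.measurableSet
  have hU := W.op_unitary
  have hQ := E.isStarProjection _ hm.compl
  have hUQ := hE.commute hm.compl
  have hincl : ∀ x, E.toFun Δᶜ (W.incl x) = W.incl x := by
    intro x
    have h1 := (W.compression_eq_zero_iff hm).mp h x
    have h2 := E.toFun_union hm hm.compl disjoint_compl_right
    rw [Set.union_compl_self, E.univ] at h2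
    have h3 := congrArg (fun T : K →L[ℂ] K => T (W.incl x)) h2
    simpa [h1] using h3.symm
  set Q := E.toFun Δᶜ
  -- UQ replaces U: its resolvent agrees with that of U on ran Q, which contains H, and survives
  -- across the conjugate arc.
  refine ⟨fun z => W.compression (Ring.inverse (1 - z • (W.op * Q))), ?_, ?_⟩
  · intro z hz
    have hunit : IsUnit (1 - z • (W.op * Q)) := by
      rcases hz with hz | ⟨ζ, hζ, hzζ⟩
      · exact isUnit_one_sub_smul_mul_of_isUnit hQ hUQ (isUnit_one_sub_smul_of_unitary hU hz)
      -- The radius c of a ball about ζ inside Δ is the lower bound: |1 - zξ| = |ζ - ξ| ≥ c off Δ.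
      · obtain ⟨c, hc, hball⟩ := Metric.isOpen_iff.mp hΔ ζ hζ
        refine isUnit_one_sub_smul_mul_of_le hU hQ hUQ hc fun x hx => ?_
        refine hE.mul_norm_le hU hm.compl hc.le (fun ξ hξ => ?_) hx
        have h1 : c ≤ dist ξ ζ := by
          by_contra hlt
          exact hξ (hball (by simpa using hlt))
        have hzz : z = (starRingEnd ℂ) (ζ : ℂ) := by rw [← hzζ, Complex.conj_conj]
        have hζn : ‖(ζ : ℂ)‖ = 1 := by simp
        have hmul : (starRingEnd ℂ) (ζ : ℂ) * ζ = 1 := by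
          rw [mul_comm, Complex.mul_conj, Complex.normSq_eq_norm_sq, hζn]; simp
        have e : 1 - z * (ξ : ℂ) = (starRingEnd ℂ) (ζ : ℂ) * ((ζ : ℂ) - ξ) := by
          rw [hzz]; linear_combination -hmul
        rw [e, norm_mul, RCLike.norm_conj, hζn, one_mul, ← dist_eq_norm, dist_comm]
        exact h1
    refine W.analyticAt_compression ?_
    obtain ⟨u, hu⟩ := hunit
    have h1 : AnalyticAt ℂ (fun w : ℂ => 1 - w • (W.op * Q)) z := by fun_prop
    have h2 : AnalyticAt ℂ Ring.inverse (1 - z • (W.op * Q)) := hu ▸ analyticAt_inverse u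
    exact AnalyticAt.fun_comp h2 h1
  · intro z hz
    have hu := isUnit_one_sub_smul_of_unitary hU hz
    have hu' := isUnit_one_sub_smul_mul_of_isUnit hQ hUQ hu
    have hQQ : Q * Q = Q := hQ.isIdempotentElem.eq
    have hc : Commute (1 - z • W.op) Q := (Commute.one_left _).sub_left (hUQ.smul_left z)
    have h1 : (1 - z • (W.op * Q)) * Q = (1 - z • W.op) * Q := by
      simp only [sub_mul, smul_mul_assoc, mul_assoc, hQQ]
    have h2 : Ring.inverse (1 - z • (W.op * Q)) * Q = Ring.inverse (1 - z • W.op) * Q := by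
      have h3 : Ring.inverse (1 - z • W.op) * Q = Q * Ring.inverse (1 - z • W.op) := by
        obtain ⟨u, hu⟩ := hu
        rw [← hu, Ring.inverse_unit]
        rw [← hu] at hc
        exact hc.units_inv_left.eq
      calc Ring.inverse (1 - z • (W.op * Q)) * Q
          = Ring.inverse (1 - z • (W.op * Q)) *
            (((1 - z • W.op) * Q) * Ring.inverse (1 - z • W.op)) := by
              rw [mul_assoc, ← h3, ← mul_assoc (1 - z • W.op), Ring.mul_inverse_cancel _ hu,
                one_mul]
        _ = (Ring.inverse (1 - z • (W.op * Q)) * (1 - z • (W.op * Q))) *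
            (Q * Ring.inverse (1 - z • W.op)) := by
              rw [← h1]; simp only [mul_assoc]
        _ = Ring.inverse (1 - z • W.op) * Q := by
              rw [Ring.inverse_mul_cancel _ hu', one_mul, h3]
    ext x
    have h4 := congrArg (fun T : K →L[ℂ] K => T (W.incl x)) h2
    simp only [mul_apply_eq_comp, hincl] at h4
    simp [generalizedResolvent, compression, h4]

theorem two_mul_re_inner_generalizedResolvent {z : ℂ} (hz : z ∈ offCircle) (x : H) :
    ∃ y : K, y - z • W.op y = W.incl x ∧
      2 * (inner ℂ x (W.generalizedResolvent z x)).re - ‖x‖ ^ 2 = (1 - ‖z‖ ^ 2) * ‖y‖ ^ 2 := by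
  have hu := isUnit_one_sub_smul_of_unitary W.op_unitary hz
  have hy : Ring.inverse (1 - z • W.op) (W.incl x)
      - z • W.op (Ring.inverse (1 - z • W.op) (W.incl x)) = W.incl x := by
    have := congrArg (fun T : K →L[ℂ] K => T (W.incl x)) (Ring.mul_inverse_cancel _ hu)
    simpa using this
  refine ⟨_, hy, ?_⟩
  rw [generalizedResolvent, W.inner_compression, ← two_mul_re_inner_sub_norm_sq W.op_unitary hy,
    W.incl.norm_map]

/-- Radial limits of `2 Re (x, R_z x) - ‖x‖²` vanish at the points of continuity of an extension
of the generalized resolvent. -/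
theorem tendsto_radial {G : ℂ → H →L[ℂ] H} (hGR : Set.EqOn G W.generalizedResolvent offCircle)
    {z : ℂ} (hz : ‖z‖ = 1) (hG : ContinuousAt G z) (x : H) :
    Tendsto (fun s : ℝ =>
      2 * (inner ℂ x (W.generalizedResolvent ((s : ℂ) * z) x)).re - ‖x‖ ^ 2) (𝓝[<] 1) (𝓝 0) := by
  let ψ : ℝ → ℝ := fun s => 2 * (inner ℂ x (G ((s : ℂ) * z) x)).re - ‖x‖ ^ 2
  have hψ : ContinuousAt ψ 1 := by
    have h1 : ContinuousAt (fun s : ℝ => G ((s : ℂ) * z)) 1 := by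
      refine ContinuousAt.comp (g := G) (f := fun s : ℝ => (s : ℂ) * z) (by simpa using hG) ?_
      fun_prop
    have h2 : ContinuousAt (fun s : ℝ => inner ℂ x (G ((s : ℂ) * z) x)) 1 :=
      ContinuousAt.inner (𝕜 := ℂ) continuousAt_const (h1.clm_apply continuousAt_const)
    exact ((Complex.continuous_re.continuousAt.comp h2).const_mul 2).sub continuousAt_const
  have hnorm : ∀ s : ℝ, 0 < s → ‖(s : ℂ) * z‖ = s := fun s hs => by
    rw [norm_mul, hz, mul_one, Complex.norm_real, Real.norm_of_nonneg hs.le]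
  have hpos : ∀ᶠ s : ℝ in 𝓝 1, 0 < s := lt_mem_nhds one_pos
  -- Approach from |z| > 1, where 1 - |z|² < 0; the approach from inside gives the opposite
  -- inequality.
  have hle : ψ 1 ≤ 0 := by
    refine le_of_tendsto (hψ.mono_left nhdsWithin_le_nhds : Tendsto ψ (𝓝[>] 1) _) ?_
    filter_upwards [self_mem_nhdsWithin, nhdsWithin_le_nhds hpos] with s hs hs0
    have hs1 : (1 : ℝ) < s := hs
    have hoff : (s : ℂ) * z ∈ offCircle := Or.inr (by rwa [Set.mem_ofPred_eq, hnorm s hs0])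
    obtain ⟨y, -, hy⟩ := W.two_mul_re_inner_generalizedResolvent hoff x
    simp only [ψ, hGR hoff, hy, hnorm s hs0]
    exact mul_nonpos_of_nonpos_of_nonneg (by nlinarith) (sq_nonneg _)
  have hge : 0 ≤ ψ 1 := by
    refine ge_of_tendsto (hψ.mono_left nhdsWithin_le_nhds : Tendsto ψ (𝓝[<] 1) _) ?_
    filter_upwards [self_mem_nhdsWithin, nhdsWithin_le_nhds hpos] with s hs hs0
    have hs1 : s < (1 : ℝ) := hs
    have hoff : (s : ℂ) * z ∈ offCircle := Or.inl (by rwa [Set.mem_ofPred_eq, hnorm s hs0])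
    obtain ⟨y, -, hy⟩ := W.two_mul_re_inner_generalizedResolvent hoff x
    simp only [ψ, hGR hoff, hy, hnorm s hs0]
    exact mul_nonneg (by nlinarith) (sq_nonneg _)
  have h0 : ψ 1 = 0 := le_antisymm hle hge
  have hlim : Tendsto ψ (𝓝[<] 1) (𝓝 0) := h0 ▸ hψ.mono_left nhdsWithin_le_nhds
  refine hlim.congr' ?_
  filter_upwards [self_mem_nhdsWithin, nhdsWithin_le_nhds hpos] with s hs hs0
  have hs1 : s < (1 : ℝ) := hs
  have hoff : (s : ℂ) * z ∈ offCircle := Or.inl (by rwa [Set.mem_ofPred_eq, hnorm s hs0])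
  simp only [ψ, hGR hoff]

theorem scalarMeasure_closedBall_le {E : OrthogonalSpectralMeasure K}
    (hE : E.IsSpectralMeasureOf W.op) (x : H) (ζ : UnitCircle) {ε : ℝ} (hε0 : 0 < ε)
    (hε1 : ε < 1) :
    (E.scalarMeasure (W.incl x)).real (Metric.closedBall ζ ε) ≤
      4 * ε * (2 * (inner ℂ x (W.generalizedResolvent
        (((1 - ε : ℝ) : ℂ) * (starRingEnd ℂ) (ζ : ℂ)) x)).re - ‖x‖ ^ 2) := by
  have hJ : MeasurableSet (Metric.closedBall ζ ε) := measurableSet_closedBall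
  have hn : ‖((1 - ε : ℝ) : ℂ) * (starRingEnd ℂ) (ζ : ℂ)‖ = 1 - ε := by
    have hζ : ‖(ζ : ℂ)‖ = 1 := by simp
    rw [norm_mul, RCLike.norm_conj, hζ, mul_one, Complex.norm_real,
      Real.norm_of_nonneg (by linarith)]
  obtain ⟨y, hy, he⟩ := W.two_mul_re_inner_generalizedResolvent
    (Or.inl (by rw [Set.mem_ofPred_eq, hn]; linarith) :
      ((1 - ε : ℝ) : ℂ) * (starRingEnd ℂ) (ζ : ℂ) ∈ offCircle) x
  have h1 := hE.norm_toFun_le W.op_unitary hJ (by positivity)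
    (fun ξ hξ => norm_one_sub_le_of_mem_closedBall hε0.le hε1.le hξ) hy
  rw [he, hn, measureReal_def, E.scalarMeasure_apply_eq_norm_sq hJ,
    ENNReal.toReal_ofReal (by positivity)]
  calc ‖E.toFun (Metric.closedBall ζ ε) (W.incl x)‖ ^ 2 ≤ (2 * ε * ‖y‖) ^ 2 := by gcongr
    _ = 4 * ε * (ε * ‖y‖ ^ 2) := by ring
    -- Here ε ≤ 2ε - ε² = 1 - |z|², which recovers the energy.
    _ ≤ 4 * ε * ((1 - (1 - ε) ^ 2) * ‖y‖ ^ 2) := by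
      gcongr
      nlinarith

theorem spectralMeasure_eq_zero_of_hasAnalyticContinuation {E : OrthogonalSpectralMeasure K}
    (hE : E.IsSpectralMeasureOf W.op) {Δ : Set UnitCircle} (hΔ : IsOpenArc Δ)
    (h : HasAnalyticContinuation W.generalizedResolvent offCircle (offCircle ∪ conjArc Δ)) :
    W.spectralMeasure E Δ = 0 := by
  have hm := hΔ.isOpen.measurableSet
  obtain ⟨G, hG, hGR⟩ := h
  refine (W.compression_eq_zero_iff hm).mpr fun x => ?_
  suffices h0 : E.scalarMeasure (W.incl x) Δ = 0 by
    rw [E.scalarMeasure_apply_eq_norm_sq hm, ENNReal.ofReal_eq_zero] at h0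
    exact norm_eq_zero.mp (pow_eq_zero_iff two_ne_zero |>.mp (le_antisymm h0 (sq_nonneg _)))
  obtain ⟨a, b, -, -, rfl⟩ := hΔ
  refine measure_arc_eq_zero _ fun ζ hζ η hη => ?_
  have hz : ‖(starRingEnd ℂ) (ζ : ℂ)‖ = 1 := by rw [RCLike.norm_conj]; simp
  have hcont : ContinuousAt G ((starRingEnd ℂ) (ζ : ℂ)) :=
    (hG _ (Or.inr ⟨ζ, hζ, Complex.conj_conj _⟩)).continuousAt
  have hlim := W.tendsto_radial hGR hz hcont x
  have hsub : Tendsto (fun ε : ℝ => 1 - ε) (𝓝[>] 0) (𝓝[<] 1) := by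
    refine tendsto_nhdsWithin_iff.mpr ⟨?_, ?_⟩
    · have : Continuous fun ε : ℝ => 1 - ε := by fun_prop
      simpa using (this.tendsto 0).mono_left nhdsWithin_le_nhds
    · filter_upwards [self_mem_nhdsWithin] with ε hε
      simpa using hε
  -- The threshold η/4 absorbs the factor 4 in the ball estimate.
  have hsmall := (hlim.comp hsub).eventually (gt_mem_nhds (show (0 : ℝ) < η / 4 by positivity))
  filter_upwards [hsmall, Ioo_mem_nhdsGT (zero_lt_one' ℝ)] with ε hε hε01
  refine (W.scalarMeasure_closedBall_le hE x ζ hε01.1 hε01.2).trans ?_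
  simp only [Function.comp_apply] at hε
  nlinarith [hε01.1]

end UnitaryExtension

end

theorem proposition3p1
    {H : Type*} [NormedAddCommGroup H] [InnerProductSpace ℂ H] [CompleteSpace H]
    (V : H →ₗ.[ℂ] H) (hV : IsClosedIsometric V)
    {K : Type*} [NormedAddCommGroup K] [InnerProductSpace ℂ K] [CompleteSpace K]
    (W : UnitaryExtension V K)
    (E : OrthogonalSpectralMeasure K) (hE : E.IsSpectralMeasureOf W.op)
    (Δ : Set UnitCircle) (hΔ : IsOpenArc Δ) :
    W.spectralMeasure E Δ = 0 ↔
      HasAnalyticContinuation W.generalizedResolvent offCircle (offCircle ∪ conjArc Δ) :=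
  ⟨W.hasAnalyticContinuation_of_spectralMeasure_eq_zero hE hΔ.isOpen,
    W.spectralMeasure_eq_zero_of_hasAnalyticContinuation hE hΔ⟩
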